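/- **Notation.** Let $V\subset\mathbb C^n$ be an algebraic set, $I(V)\subset\mathbb C[X_1,\dots,X_n]$ the ideal of polynomials vanishing on $V$, and $\dim V$ the Krull dimension of $\mathbb C[X_1,\dots,X_n]/I(V)$. Write $\pi_i(x_1,\dots,x_n)=(x_1,\dots,x_i)$, and let $\Omega_r(V)$ be the union of the irreducible components of $V$ of dimension $r$. A point $x$ of $W=\Omega_r(V)$ is regular if the Jacobian matrix of a system of generators of $I(W)$ has rank $n-r$ at $x$, and singular otherwise ($\operatorname{reg}W$, $\operatorname{sing}W$ are the sets of such points). For $i\le r$, $\operatorname{crit}(\pi_i,\operatorname{reg}W)$ is the set of $x\in\operatorname{reg}W$ at which this Jacobian matrix with its first $i$ columns removed has rank less than $n-r$. Put $$\mathscr S(V)=\Omega_0(V)\cup\dots\cup\Omega_{e-1}(V)\cup\operatorname{sing}(\Omega_e(V)),\qquad e=\dim V,$$ with $\mathscr S(\emptyset)=\emptyset$, and let $\mathscr C(\pi_i,V)$ be the Zariski closure of $$\Omega_0(V)\cup\dots\cup\Omega_{i-1}(V)\cup\bigcup_{r\ge i}\operatorname{crit}(\pi_i,\operatorname{reg}(\Omega_r(V))).$$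 If $\dim V=d$, define $\mathcal O_d(V)=V$ and, for $i=d-1,\dots,0$, $$\mathcal O_i(V)=\mathscr S(\mathcal O_{i+1}(V))\cup\mathscr C(\pi_{i+1},\mathcal O_{i+1}(V))\cup\mathscr C(\pi_{i+1},V).$$ For $M\in\mathrm{GL}(n,\mathbb C)$ and $Z\subset\mathbb C^n$ algebraic of dimension $d$, let $M^{-1}Z=\{x\in\mathbb C^n: Mx\in Z\}$. We say that $M$ satisfies $\mathsf P(Z)$ if, for all $i=0,\dots,d$, $\mathcal O_i(M^{-1}Z)$ has dimension at most $i$ and is in Noether position with respect to $X_1,\dots,X_i$, i.e. $\mathbb C[X_1,\dots,X_n]/I(\mathcal O_i(M^{-1}Z))$ is integral over $\mathbb C[X_1,\dots,X_i]$. **Lemma 5.3.** Let $n\ge 1$, let $Z\subset\mathbb C^n$ be an algebraic set of dimension $d\ge 0$, and let $M\in\mathrm{GL}(n,\mathbb C)$ be such that $M^{-1}Z$ is the zero set in $\mathbb C^n$ of polynomials with real coefficients (for instance, $Z$ is defined by polynomials with rational coefficients and $M\in\mathrm{GL}(n,\mathbb Q)$). Suppose that $M$ satisfies $\mathsf P(Z)$.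 Let $M^{-1}\mathcal C$ be a connected component of $M^{-1}Z\cap\mathbb R^n$ (for the Euclidean topology), and let $t\in\mathbb R$ lie on the boundary of $\pi_1(M^{-1}\mathcal C)$ in $\mathbb R$. Then $\pi_1^{-1}(t)\cap M^{-1}\mathcal C$ is a non-empty finite set contained in $\mathcal O_0(M^{-1}Z)\cap M^{-1}\mathcal C$. -/

import Mathlib

namespace PolarVarieties

open MvPolynomial

/-- `V ⊆ ℂⁿ` is the set of common complex zeros of polynomials with coefficients in `k`
(equivalently of finitely many, since the polynomial ring is Noetherian). -/
def IsAlgebraicOver (k : Type) [Field k] [Algebra k ℂ] {n : ℕ} (V : Set (Fin n → ℂ)) : Prop :=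
  ∃ I : Ideal (MvPolynomial (Fin n) k), V = zeroLocus ℂ I

/-- The set `M⁻¹ Z = {x ∈ ℂⁿ : M x ∈ Z}`. -/
def invImage {n : ℕ} (M : GL (Fin n) ℂ) (Z : Set (Fin n → ℂ)) : Set (Fin n → ℂ) :=
  {x | (M : Matrix (Fin n) (Fin n) ℂ).mulVec x ∈ Z}

/-- The inclusion `ℝⁿ ⊆ ℂⁿ`. -/
def toComplex {n : ℕ} (y : Fin n → ℝ) : Fin n → ℂ := fun i => (y i : ℂ)

/-- The real trace `V ∩ ℝⁿ`, as a subset of `ℝⁿ`. -/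
def realPoints {n : ℕ} (V : Set (Fin n → ℂ)) : Set (Fin n → ℝ) := {y | toComplex y ∈ V}

/-- `C` is a connected component of the (Euclidean) subspace `S` of `ℝⁿ`. -/
def IsConnComponentOf {n : ℕ} (C S : Set (Fin n → ℝ)) : Prop :=
  ∃ y ∈ S, C = connectedComponentIn S y

/-- The ideal `I(V)` of all complex polynomials vanishing on `V`. -/
noncomputable abbrev idealOf {n : ℕ} (V : Set (Fin n → ℂ)) : Ideal (MvPolynomial (Fin n) ℂ) :=
  vanishingIdeal ℂ V

/-- The coordinate ring `ℂ[X] / I(V)`. -/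
abbrev coordRing {n : ℕ} (V : Set (Fin n → ℂ)) : Type :=
  MvPolynomial (Fin n) ℂ ⧸ idealOf V

/-- The dimension of an algebraic set: the Krull dimension of its coordinate ring
(it is `⊥` exactly for the empty set). -/
noncomputable def algDim {n : ℕ} (V : Set (Fin n → ℂ)) : WithBot ℕ∞ := ringKrullDim (coordRing V)

/-- The Zariski closure of a subset of `ℂⁿ`. -/
def zariskiClosure {n : ℕ} (S : Set (Fin n → ℂ)) : Set (Fin n → ℂ) := zeroLocus ℂ (idealOf S)

/-- `Ω_r(V)`: the union of the irreducible components of `V` of dimension `r`. The irreducible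
components of an algebraic set `V` are the zero sets of the minimal primes `P` over `I(V)`, the
component belonging to `P` having coordinate ring `ℂ[X] / P`. -/
def equidimComp {n : ℕ} (r : ℕ) (V : Set (Fin n → ℂ)) : Set (Fin n → ℂ) :=
  {x | ∃ P ∈ (idealOf V).minimalPrimes,
    ringKrullDim (MvPolynomial (Fin n) ℂ ⧸ P) = (r : WithBot ℕ∞) ∧ x ∈ zeroLocus ℂ P}

/-- The rank at `x ∈ V` of the Jacobian matrix of a system of generators of `I(V)` with its first
`i` columns deleted (here: replaced by zero). The row space at a point `x ∈ V` does not depend on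
the generators, and is the span of the rows belonging to all `f ∈ I(V)`. -/
noncomputable def jacRank {n : ℕ} (i : ℕ) (V : Set (Fin n → ℂ)) (x : Fin n → ℂ) : ℕ :=
  Module.finrank ℂ (Submodule.span ℂ
    {w : Fin n → ℂ | ∃ f ∈ idealOf V,
      w = fun k : Fin n => if (k : ℕ) < i then 0 else eval x (pderiv k f)})

/-- The regular points of an `r`-equidimensional algebraic set `V`: the Jacobian matrix of
generators of `I(V)` has rank `n - r`. -/
def reg {n : ℕ} (r : ℕ) (V : Set (Fin n → ℂ)) : Set (Fin n → ℂ) :=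
  {x | x ∈ V ∧ jacRank 0 V x + r = n}

/-- The singular points of an `r`-equidimensional algebraic set `V`. -/
def sing {n : ℕ} (r : ℕ) (V : Set (Fin n → ℂ)) : Set (Fin n → ℂ) :=
  {x | x ∈ V ∧ jacRank 0 V x + r ≠ n}

/-- The critical points of the restriction to `reg V` of the projection
`π_i : (x_1, …, x_n) ↦ (x_1, …, x_i)`, where `V` is `r`-equidimensional: all minors of size `n - r`
of the Jacobian matrix with its first `i` columns deleted vanish. -/
def critReg {n : ℕ} (i r : ℕ) (V : Set (Fin n → ℂ)) : Set (Fin n → ℂ) :=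
  {x | x ∈ reg r V ∧ jacRank i V x + r < n}

/-- `𝒮(V) = Ω_0(V) ∪ ⋯ ∪ Ω_{d-1}(V) ∪ sing(Ω_d(V))`, where `d = dim V`. -/
def singLocus {n : ℕ} (V : Set (Fin n → ℂ)) : Set (Fin n → ℂ) :=
  {x | ∃ d : ℕ, algDim V = (d : WithBot ℕ∞) ∧
    ((∃ r < d, x ∈ equidimComp r V) ∨ x ∈ sing d (equidimComp d V))}

/-- `𝒞(π_i, V)`: the Zariski closure of the union of `Ω_0(V), …, Ω_{i-1}(V)` and of the sets
`crit(π_i, reg(Ω_r(V)))` for `r ≥ i`. -/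
def critLocus {n : ℕ} (i : ℕ) (V : Set (Fin n → ℂ)) : Set (Fin n → ℂ) :=
  zariskiClosure {x | (∃ r < i, x ∈ equidimComp r V) ∨
    ∃ r, i ≤ r ∧ x ∈ critReg i r (equidimComp r V)}

/-- Descending recursion: `polarAux d V k` is `𝒪_{d-k}(V)`, for `k ≤ d = dim V`:
`𝒪_d(V) = V` and `𝒪_i(V) = 𝒮(𝒪_{i+1}(V)) ∪ 𝒞(π_{i+1}, 𝒪_{i+1}(V)) ∪ 𝒞(π_{i+1}, V)`;
in the step from `k` to `k + 1` the index `i + 1` is `d - k`. -/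
def polarAux {n : ℕ} (d : ℕ) (V : Set (Fin n → ℂ)) : ℕ → Set (Fin n → ℂ)
  | 0 => V
  | k + 1 => singLocus (polarAux d V k) ∪ critLocus (d - k) (polarAux d V k) ∪ critLocus (d - k) V

/-- `𝒪_i(V)` for `0 ≤ i ≤ d`, where `d = dim V`. -/
def polar {n : ℕ} (d : ℕ) (V : Set (Fin n → ℂ)) (i : ℕ) : Set (Fin n → ℂ) := polarAux d V (d - i)

/-- `V` is in Noether position with respect to `X_1, …, X_i`: the ring map
`ℂ[X_1, …, X_i] → ℂ[X_1, …, X_n] / I(V)` is integral. -/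
def IsNoetherPosition {n : ℕ} (i : ℕ) (V : Set (Fin n → ℂ)) : Prop :=
  ((Ideal.Quotient.mk (idealOf V)).comp
    (rename (R := ℂ) (Subtype.val : {k : Fin n // (k : ℕ) < i} → Fin n)).toRingHom).IsIntegral

/-- Property `P(Z)` of `M ∈ GL(n, ℂ)`, for an algebraic set `Z ⊆ ℂⁿ` of dimension `d`. -/
def PropertyP {n : ℕ} (d : ℕ) (Z : Set (Fin n → ℂ)) (M : GL (Fin n) ℂ) : Prop :=
  ∀ i : ℕ, i ≤ d →
    algDim (polar d (invImage M Z) i) ≤ (i : WithBot ℕ∞) ∧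
    IsNoetherPosition i (polar d (invImage M Z) i)

end PolarVarieties

/-!
Write `V = M⁻¹ Z`, let `C` be the connected component, and let `π_i` also denote the projection
`ℝⁿ → ℝ^i`. A descending induction on `i` shows that `π_i(C)` is closed, and that the points of `C`
over the boundary of `π_i(C)` lie on `𝒪_{i-1}(V)`
(`isClosed_cylinder_and_mem_polarAux`). For `i = 1` this gives the non-emptiness of the fibre and its
inclusion in `𝒪_0(V)`, which is finite by Noether position with respect to no variables.

*Closedness.* Noether position makes `π_i` proper on `𝒪_i(V)` (`exists_bound_of_isIntegral`). Let `t`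
be a limit of points of `π_i(C)`. If `t` is a limit of projections of points of `C ∩ 𝒪_i(V)`, it is
in `π_i(C)` by properness. Otherwise, for `y ∈ π_i(C)` close to `t`, the line over `y` in `ℝ^{i+1}`
contains no boundary point of `π_{i+1}(C)`, since the points of `C` above such a boundary point are
in `𝒪_i(V)`; hence the line lies in `π_{i+1}(C)`. So near `t` membership in `π_i(C)` is a closed
condition, because `π_{i+1}(C)` is closed (`isClosed_cylinder_of_succ`). The induction starts at
`i = d + 1`, where closedness is properness on `𝒪_d(V) = V` alone.

*Location of the boundary points.* If `x ∈ C` lies over the boundary of `π_i(C)`, it lies over the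
boundary of `π_{i+1}(C)`, so `x ∈ W := 𝒪_i(V)`. If `x` were not in `𝒪_{i-1}(V)`, it would be a regular
point of the `i`-dimensional part of `W`, not critical for `π_i`. The first `i` coordinates and
suitable elements of `I(W)` then form local coordinates at `x` (`exists_local_coordinates`), while
`π_i` is open at `x` on the component of `W` through `x`, by Noether position (`projection_open`).
So over each real `y` near `π_i(x)` there is exactly one point of that component near `x`. It is
real, since its conjugate also lies on `W`, and it depends continuously on `y`; hence it lies in `C`,
and `x` lies over the interior of `π_i(C)` (`eventually_exists_mem_component`).

The loci `𝒮(W)` and `𝒞(π_i, W)` depend only on `I(W)`, so nowhere is it needed that the sets `𝒪_i(V)`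
are Zariski closed: their Zariski closures serve instead.
-/

namespace PolarVarieties

open MvPolynomial Filter Topology

/-! ### The projections `π_i` in Noether position -/

/-- The index type of the first `i` of `n` coordinates. -/
abbrev Low (n i : ℕ) : Type := {k : Fin n // (k : ℕ) < i}

/-- The projection `π_i` onto the first `i` coordinates. -/
def proj {n : ℕ} (i : ℕ) (z : Fin n → ℂ) : Low n i → ℂ := fun k => z k

/-- The ring map `ℂ[X_1, …, X_i] → ℂ[X_1, …, X_n] / I`. -/
noncomputable def lowMap {n : ℕ} (i : ℕ) (I : Ideal (MvPolynomial (Fin n) ℂ)) :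
    MvPolynomial (Low n i) ℂ →+* MvPolynomial (Fin n) ℂ ⧸ I :=
  (Ideal.Quotient.mk I).comp (rename (R := ℂ) (Subtype.val : Low n i → Fin n)).toRingHom

/-- Evaluation at a zero of `I`, as a ring map on the quotient by `I`. -/
noncomputable def evalQuot {n : ℕ} {I : Ideal (MvPolynomial (Fin n) ℂ)} {z : Fin n → ℂ}
    (hz : z ∈ zeroLocus ℂ I) : MvPolynomial (Fin n) ℂ ⧸ I →+* ℂ :=
  Ideal.Quotient.lift I (eval z) fun p hp => by simpa [aeval_eq_eval] using hz p hp

@[simp]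
lemma evalQuot_mk {n : ℕ} {I : Ideal (MvPolynomial (Fin n) ℂ)} {z : Fin n → ℂ}
    (hz : z ∈ zeroLocus ℂ I) (p : MvPolynomial (Fin n) ℂ) :
    evalQuot hz (Ideal.Quotient.mk I p) = eval z p := by
  rfl

lemma evalQuot_comp_lowMap {n i : ℕ} {I : Ideal (MvPolynomial (Fin n) ℂ)} {z : Fin n → ℂ}
    (hz : z ∈ zeroLocus ℂ I) : (evalQuot hz).comp (lowMap i I) = eval (proj i z) := by
  ext k
  · simp [lowMap]
  · simp [lowMap, proj]

lemma eval_map_eq_zero_of_eval₂_lowMap {n i : ℕ} {I : Ideal (MvPolynomial (Fin n) ℂ)}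
    {z : Fin n → ℂ} (hz : z ∈ zeroLocus ℂ I) {p : Polynomial (MvPolynomial (Low n i) ℂ)}
    {g : MvPolynomial (Fin n) ℂ} (hp : p.eval₂ (lowMap i I) (Ideal.Quotient.mk I g) = 0) :
    (p.map (eval (proj i z))).eval (eval z g) = 0 := by
  have := congrArg (evalQuot hz) hp
  rw [Polynomial.hom_eval₂, evalQuot_comp_lowMap, evalQuot_mk, map_zero] at this
  rwa [Polynomial.eval_map]

lemma lowMap_isIntegral_mono {n i : ℕ} {I J : Ideal (MvPolynomial (Fin n) ℂ)} (h : I ≤ J)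
    (hI : (lowMap i I).IsIntegral) : (lowMap i J).IsIntegral := by
  have : lowMap i J = (Ideal.Quotient.factor h).comp (lowMap i I) := by
    ext k <;> simp [lowMap]
  rw [this]
  exact hI.trans _ _ (RingHom.isIntegral_of_surjective _ (Ideal.Quotient.factor_surjective h))

/-- Noether position makes the projection `π_i` proper on the zero locus: each coordinate is a root
of a monic polynomial with coefficients polynomial in the first `i` coordinates. -/
lemma exists_bound_of_isIntegral {n i : ℕ} {I : Ideal (MvPolynomial (Fin n) ℂ)}
    (hI : (lowMap i I).IsIntegral) {K : Set (Low n i → ℂ)} (hK : IsCompact K) :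
    ∃ B : ℝ, ∀ z ∈ zeroLocus ℂ I, proj i z ∈ K → ‖z‖ ≤ B := by
  have key (k : Fin n) : ∃ B : ℝ, ∀ z ∈ zeroLocus ℂ I, proj i z ∈ K → ‖z k‖ ≤ B := by
    obtain ⟨p, hp, hp0⟩ := hI (Ideal.Quotient.mk I (X k))
    have hb (j : ℕ) : ∃ B : ℝ, ∀ y ∈ K, ‖eval y (p.coeff j)‖ ≤ B :=
      hK.exists_bound_of_continuousOn (MvPolynomial.continuous_eval _).continuousOn
    choose B hB using hb
    refine ⟨((∑ j ∈ Finset.range p.natDegree, (B j).toNNReal) + 1 : NNReal), fun z hz hzK => ?_⟩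
    have hroot := eval_map_eq_zero_of_eval₂_lowMap hz hp0
    rw [eval_X] at hroot
    have hm := hp.map (eval (proj i z))
    have h1 := Polynomial.IsRoot.norm_lt_cauchyBound hm.ne_zero hroot
    have h2 : Polynomial.cauchyBound (p.map (eval (proj i z))) ≤
        (∑ j ∈ Finset.range p.natDegree, (B j).toNNReal) + 1 := by
      rw [Polynomial.cauchyBound, hm.leadingCoeff, hp.natDegree_map, nnnorm_one, div_one]
      gcongr
      refine Finset.sup_le fun j hj => ?_
      refine le_trans ?_ (Finset.single_le_sum (f := fun j => (B j).toNNReal)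
        (fun _ _ => zero_le) hj)
      rw [Polynomial.coeff_map]
      exact NNReal.le_toNNReal_of_coe_le (hB j _ hzK)
    exact_mod_cast h1.le.trans h2
  choose B hB using key
  refine ⟨∑ k, |B k|, fun z hz hzK => (pi_norm_le_iff_of_nonneg (by positivity)).2 fun k => ?_⟩
  exact (hB k z hz hzK).trans ((le_abs_self _).trans
    (Finset.single_le_sum (f := fun k => |B k|) (fun _ _ => abs_nonneg _) (Finset.mem_univ k)))

/-- Noether position makes the fibres of `π_i` finite. -/
lemma finite_fibre_of_isIntegral {n i : ℕ} {I : Ideal (MvPolynomial (Fin n) ℂ)}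
    (hI : (lowMap i I).IsIntegral) (y : Low n i → ℂ) :
    {z ∈ zeroLocus ℂ I | proj i z = y}.Finite := by
  choose p hp hp0 using fun k : Fin n => hI (Ideal.Quotient.mk I (X k))
  refine (Set.Finite.pi (t := fun k => {a | ((p k).map (eval y)).IsRoot a}) fun k =>
    Polynomial.finite_setOfPred_isRoot ((hp k).map _).ne_zero).subset ?_
  rintro z ⟨hz, rfl⟩ k -
  simpa using eval_map_eq_zero_of_eval₂_lowMap hz (hp0 k)

lemma isClosed_zeroLocus {n : ℕ} (I : Ideal (MvPolynomial (Fin n) ℂ)) :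
    IsClosed (zeroLocus ℂ I) := by
  have : zeroLocus ℂ I = ⋂ p ∈ I, {z | eval z p = 0} := by
    ext z; simp [aeval_eq_eval]
  rw [this]
  exact isClosed_biInter fun p _ => isClosed_eq (MvPolynomial.continuous_eval p) continuous_const

lemma ringKrullDim_le_of_isIntegral {A B : Type*} [CommRing A] [CommRing B] [Algebra A B]
    [Algebra.IsIntegral A B] : ringKrullDim B ≤ ringKrullDim A :=
  Order.krullDim_le_of_strictMono (PrimeSpectrum.comap (algebraMap A B)) fun _ _ h =>
    Ideal.IsIntegral.comap_lt_comap (R := A) h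

/-- An integral ring map from a domain to a ring of at least the same finite dimension is
injective. -/
lemma injective_of_isIntegral_of_ringKrullDim_le {A B : Type*} [CommRing A] [IsDomain A]
    [CommRing B] (f : A →+* B) (hf : f.IsIntegral) {m : ℕ}
    (hA : ringKrullDim A ≤ m) (hB : (m : WithBot ℕ∞) ≤ ringKrullDim B) :
    Function.Injective f := by
  rw [injective_iff_map_eq_zero]
  intro a ha
  by_contra ha0
  let g : A ⧸ Ideal.span {a} →+* B := Ideal.Quotient.lift _ f fun b hb => by
    obtain ⟨c, rfl⟩ := Ideal.mem_span_singleton'.1 hb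
    simp [ha]
  have hg : g.IsIntegral := by
    refine RingHom.IsIntegral.tower_top (Ideal.Quotient.mk _) g ?_
    rwa [Ideal.Quotient.lift_comp_mk]
  let _ := g.toAlgebra
  have : Algebra.IsIntegral (A ⧸ Ideal.span {a}) B := ⟨hg⟩
  have h1 := ringKrullDim_le_of_isIntegral (A := A ⧸ Ideal.span {a}) (B := B)
  have h2 := ringKrullDim_quotient_succ_le_of_nonZeroDivisor (mem_nonZeroDivisors_of_ne_zero ha0)
  have h3 : (m : WithBot ℕ∞) + 1 ≤ m := (add_le_add_left (hB.trans h1) 1).trans (h2.trans hA)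
  have h4 : ((m + 1 : ℕ) : WithBot ℕ∞) ≤ (m : ℕ) := by exact_mod_cast h3
  have h5 : m + 1 ≤ m := by exact_mod_cast h4
  omega

/-! ### Openness of the projections -/

/-- A monic complex polynomial of positive degree has a root bounded in terms of its constant
coefficient, which is up to sign the product of the roots. -/
lemma exists_isRoot_norm_pow_le {p : Polynomial ℂ} (hp : p.Monic) (hd : 0 < p.natDegree) :
    ∃ a, p.IsRoot a ∧ ‖a‖ ^ p.natDegree ≤ ‖p.coeff 0‖ := by
  by_contra! h
  have hs := IsAlgClosed.splits p
  have h0 : ‖p.coeff 0‖ = (p.roots.map norm).prod := by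
    rw [hs.coeff_zero_eq_prod_roots_of_monic hp, norm_mul, norm_pow, norm_neg, norm_one, one_pow,
      one_mul]
    exact map_multiset_prod (normHom (α := ℂ)) _
  have hN : p.natDegree ≠ 0 := hd.ne'
  rcases (norm_nonneg (p.coeff 0)).lt_or_eq' with hpos | hzero
  · -- `c` is the geometric mean of the absolute values of the roots
    set c : ℝ := ‖p.coeff 0‖ ^ ((p.natDegree : ℝ)⁻¹) with hc
    have hcp : c ^ p.natDegree = ‖p.coeff 0‖ := Real.rpow_inv_natCast_pow (norm_nonneg _) hN
    have hc0 : 0 < c := Real.rpow_pos_of_pos hpos _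
    have hlt (a) (ha : a ∈ p.roots) : c < ‖a‖ :=
      lt_of_pow_lt_pow_left₀ _ (norm_nonneg _) (hcp ▸ h a (Polynomial.isRoot_of_mem_roots ha))
    have h2 : (p.roots.map fun _ => c).prod < (p.roots.map norm).prod := by
      refine Multiset.prod_map_lt_prod_map ?_ _ _ (fun _ _ => hc0) hlt
      rwa [← Multiset.card_pos, ← hs.natDegree_eq_card_roots]
    rw [Multiset.map_const', Multiset.prod_replicate, ← hs.natDegree_eq_card_roots, hcp, h0] at h2
    exact lt_irrefl _ h2
  · have := h 0 (by simpa [Polynomial.IsRoot, Polynomial.coeff_zero_eq_eval_zero] using hzero)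
    rw [norm_zero, zero_pow hN, hzero] at this
    exact lt_irrefl _ this

/-- An element of an integral extension domain of an integrally closed domain is a root of a monic
polynomial that divides every polynomial vanishing at it. Stated for a bare ring map, so that it
can be used without a second algebra structure on the quotient rings. -/
lemma exists_minimal_polynomial {A B : Type*} [CommRing A] [IsDomain A] [IsIntegrallyClosed A]
    [CommRing B] [IsDomain B] (f : A →+* B) (hf : f.IsIntegral) (hinj : Function.Injective f)
    (b : B) : ∃ m : Polynomial A, m.Monic ∧ 0 < m.natDegree ∧ m.eval₂ f b = 0 ∧
      ∀ q : Polynomial A, q.eval₂ f b = 0 → m ∣ q := by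
  let _ := f.toAlgebra
  have hint : Algebra.IsIntegral A B := ⟨hf⟩
  have : FaithfulSMul A B := (faithfulSMul_iff_algebraMap_injective _ _).2 hinj
  have hb := hint.isIntegral b
  exact ⟨minpoly A b, minpoly.monic hb, minpoly.natDegree_pos hb, minpoly.aeval A b,
    fun q hq => minpoly.isIntegrallyClosed_dvd hb hq⟩

/-- Over any `y`, each root of the minimal polynomial of `g` specialised at `y` is the value of `g`
at a point of the zero locus of `P` over `y`: lying over for `ℂ[X_1, …, X_i][g] ⊆ ℂ[X] / P`. -/
lemma exists_mem_zeroLocus_eval_eq {n i : ℕ} {P : Ideal (MvPolynomial (Fin n) ℂ)}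
    (hP : (lowMap i P).IsIntegral) (g : MvPolynomial (Fin n) ℂ)
    {m : Polynomial (MvPolynomial (Low n i) ℂ)}
    (hm : ∀ q : Polynomial (MvPolynomial (Low n i) ℂ),
      q.eval₂ (lowMap i P) (Ideal.Quotient.mk P g) = 0 → m ∣ q)
    {y : Low n i → ℂ} {a : ℂ} (ha : (m.map (eval y)).IsRoot a) :
    ∃ z ∈ zeroLocus ℂ P, proj i z = y ∧ eval z g = a := by
  let ψ := Polynomial.eval₂RingHom (lowMap i P) (Ideal.Quotient.mk P g)
  let e : Polynomial (MvPolynomial (Low n i) ℂ) →+* ℂ := Polynomial.eval₂RingHom (eval y) a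
  have hψ : ψ.IsIntegral := by
    refine RingHom.IsIntegral.tower_top Polynomial.C ψ ?_
    have hC : ψ.comp Polynomial.C = lowMap i P := RingHom.ext fun c => by simp [ψ]
    rwa [hC]
  let _ := ψ.toAlgebra
  have : Algebra.IsIntegral (Polynomial (MvPolynomial (Low n i) ℂ)) (MvPolynomial (Fin n) ℂ ⧸ P) :=
    ⟨hψ⟩
  have hesurj : Function.Surjective e := fun c => ⟨Polynomial.C (C c), by simp [e]⟩
  have hmax : (RingHom.ker e).IsMaximal := RingHom.ker_isMaximal_of_surjective e hesurj
  have hker : RingHom.ker ψ ≤ RingHom.ker e := by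
    intro q hq
    obtain ⟨r, rfl⟩ := hm q hq
    have : e m = 0 := by simpa [e, Polynomial.IsRoot, Polynomial.eval_map] using ha
    simp [RingHom.mem_ker, this]
  obtain ⟨Q, hQ, hQe⟩ := Ideal.exists_ideal_over_maximal_of_isIntegral
    (S := MvPolynomial (Fin n) ℂ ⧸ P) (RingHom.ker e) hker
  have hQ' : (Q.comap (Ideal.Quotient.mk P)).IsMaximal :=
    Ideal.comap_isMaximal_of_surjective _ Ideal.Quotient.mk_surjective
  obtain ⟨z, hz⟩ := (isMaximal_iff_eq_vanishingIdeal_singleton).1 hQ'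
  have hmem (p : MvPolynomial (Fin n) ℂ) (hp : Ideal.Quotient.mk P p ∈ Q) : eval z p = 0 := by
    have : p ∈ vanishingIdeal ℂ {z} := hz ▸ hp
    simpa [aeval_eq_eval] using this
  have hmem' (q) (hq : e q = 0) : ψ q ∈ Q := by
    have : q ∈ Q.comap ψ := by rw [show Q.comap ψ = RingHom.ker e from hQe]; exact hq
    exact this
  refine ⟨z, fun p hp => ?_, ?_, ?_⟩
  · rw [aeval_eq_eval]
    exact hmem p (by simp [Ideal.Quotient.eq_zero_iff_mem.2 hp])
  · ext k
    have := hmem' (Polynomial.C (X k - C (y k))) (by simp [e])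
    have := hmem (X k.1 - C (y k)) (by simpa [ψ, lowMap] using this)
    simpa [sub_eq_zero, proj] using this
  · have := hmem' (Polynomial.X - Polynomial.C (C a)) (by simp [e])
    have := hmem (g - C a) (by simpa [ψ, lowMap] using this)
    simpa [sub_eq_zero] using this

/-- A point outside a finite set is separated from it by a polynomial. -/
lemma exists_eval_eq_zero_of_finite {n : ℕ} (x : Fin n → ℂ) {S : Set (Fin n → ℂ)} (hS : S.Finite)
    (hx : x ∉ S) : ∃ g : MvPolynomial (Fin n) ℂ, eval x g = 0 ∧ ∀ p ∈ S, eval p g ≠ 0 := by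
  have hsep (p : Fin n → ℂ) : ∃ h : MvPolynomial (Fin n) ℂ, p ≠ x → eval x h = 1 ∧ eval p h = 0 := by
    by_cases hp : p = x
    · exact ⟨0, fun h => absurd hp h⟩
    · obtain ⟨k, hk⟩ := Function.ne_iff.1 hp
      have hk' : x k - p k ≠ 0 := sub_ne_zero.2 (Ne.symm hk)
      exact ⟨C (x k - p k)⁻¹ * (X k - C (p k)), fun _ => by simp [hk']⟩
  choose h hh using hsep
  refine ⟨1 - ∏ p ∈ hS.toFinset, h p, ?_, fun p hp => ?_⟩
  · rw [map_sub, map_one, map_prod, Finset.prod_eq_one, sub_self]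
    intro p hp
    exact (hh p (by rintro rfl; exact hx (by simpa using hp))).1
  · rw [map_sub, map_one, map_prod, Finset.prod_eq_zero (i := p) (by simpa using hp), sub_zero]
    · exact one_ne_zero
    · exact (hh p (by rintro rfl; exact hx hp)).2

/-- If `ℂ[X] / P` is integral over `ℂ[X_1, …, X_i]` and has dimension `i`, then `π_i` is open as a
map from the zero locus of `P` to `ℂ^i`. Take `g` vanishing at `x` but not elsewhere in the fibre of
`x`. The constant coefficient of its minimal polynomial vanishes at `π_i x`, so over nearby `y` there
are points of the zero locus at which `g` is small, and by properness they are near `x`. -/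
lemma projection_open {n i : ℕ} {P : Ideal (MvPolynomial (Fin n) ℂ)} [P.IsPrime]
    (hP : (lowMap i P).IsIntegral)
    (hdim : (i : WithBot ℕ∞) ≤ ringKrullDim (MvPolynomial (Fin n) ℂ ⧸ P))
    {x : Fin n → ℂ} (hx : x ∈ zeroLocus ℂ P) {U : Set (Fin n → ℂ)} (hU : U ∈ 𝓝 x) :
    ∀ᶠ y in 𝓝 (proj i x), ∃ z ∈ zeroLocus ℂ P, proj i z = y ∧ z ∈ U := by
  have hcard : ringKrullDim (MvPolynomial (Low n i) ℂ) ≤ (i : WithBot ℕ∞) := by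
    rw [MvPolynomial.ringKrullDim_of_isNoetherianRing, ringKrullDim_eq_zero_of_field, zero_add]
    have : Nat.card (Low n i) ≤ i := by
      simpa using Nat.card_le_card_of_injective (β := Fin i)
        (fun k : Low n i => (⟨k.1, k.2⟩ : Fin i)) fun a b h => by
          ext; simpa using h
    exact_mod_cast this
  have hinj := injective_of_isIntegral_of_ringKrullDim_le _ hP hcard hdim
  obtain ⟨U', hU'U, hU'o, hxU'⟩ := mem_nhds_iff.1 hU
  -- `g` vanishes at `x` and at no other point of the fibre of `x`
  obtain ⟨g, hgx, hg⟩ := exists_eval_eq_zero_of_finite x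
    ((finite_fibre_of_isIntegral hP (proj i x)).subset
      (Set.sdiff_subset (t := {x}))) (by simp)
  obtain ⟨m, hmonic, hdeg, hmg, hdvd⟩ := exists_minimal_polynomial _ hP hinj (Ideal.Quotient.mk P g)
  have hm0 : eval (proj i x) (m.coeff 0) = 0 := by
    have := eval_map_eq_zero_of_eval₂_lowMap hx hmg
    rwa [hgx, ← Polynomial.coeff_zero_eq_eval_zero, Polynomial.coeff_map] at this
  -- the part of the zero locus over a unit ball and away from `x` is compact, and `(π_i, g)`
  -- does not take the value `(π_i x, 0)` there
  obtain ⟨B, hB⟩ := exists_bound_of_isIntegral hP (isCompact_closedBall (proj i x) 1)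
  have hproj : Continuous (proj i : (Fin n → ℂ) → Low n i → ℂ) := by unfold proj; fun_prop
  let K : Set (Fin n → ℂ) := (zeroLocus ℂ P ∩ proj i ⁻¹' Metric.closedBall (proj i x) 1) ∩ U'ᶜ
  have hK : IsCompact K := by
    refine (isCompact_closedBall (0 : Fin n → ℂ) B).of_isClosed_subset ?_ ?_
    · exact ((isClosed_zeroLocus P).inter (Metric.isClosed_closedBall.preimage hproj)).inter
        hU'o.isClosed_compl
    · rintro z ⟨⟨hz, hzK⟩, -⟩
      simpa using hB z hz hzK
  have hcont : Continuous fun z : Fin n → ℂ => (proj i z, eval z g) :=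
    hproj.prodMk (MvPolynomial.continuous_eval g)
  have hnot : (proj i x, (0 : ℂ)) ∉ (fun z : Fin n → ℂ => (proj i z, eval z g)) '' K := by
    rintro ⟨z, ⟨⟨hz, -⟩, hzU⟩, hzx⟩
    rw [Prod.mk.injEq] at hzx
    refine hg z ⟨⟨hz, hzx.1⟩, ?_⟩ hzx.2
    rintro rfl
    exact hzU hxU'
  have hnhds := (hK.image hcont).isClosed.isOpen_compl.mem_nhds hnot
  rw [nhds_prod_eq, Filter.mem_prod_iff] at hnhds
  obtain ⟨S, hS, T, hT, hST⟩ := hnhds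
  obtain ⟨ε, hε, hεT⟩ := Metric.mem_nhds_iff.1 hT
  have hsmall : ∀ᶠ y in 𝓝 (proj i x), ‖eval y (m.coeff 0)‖ < ε ^ m.natDegree := by
    have : Tendsto (fun y => ‖eval y (m.coeff 0)‖) (𝓝 (proj i x)) (𝓝 0) := by
      simpa [hm0] using ((MvPolynomial.continuous_eval (m.coeff 0)).norm.tendsto (proj i x))
    exact this.eventually_lt_const (by positivity)
  filter_upwards [hS, hsmall, Metric.closedBall_mem_nhds (proj i x) one_pos] with y hyS hy hy1
  obtain ⟨a, ha, hle⟩ := exists_isRoot_norm_pow_le (hmonic.map (eval y))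
    (by rwa [hmonic.natDegree_map])
  rw [hmonic.natDegree_map, Polynomial.coeff_map] at hle
  obtain ⟨z, hz, rfl, rfl⟩ := exists_mem_zeroLocus_eval_eq hP g hdvd ha
  refine ⟨z, hz, rfl, hU'U ?_⟩
  by_contra hzU
  have haT : eval z g ∈ T := hεT (by
    simpa using lt_of_pow_lt_pow_left₀ _ hε.le (hle.trans_lt hy))
  exact hST (Set.mk_mem_prod hyS haT) ⟨z, ⟨⟨hz, hy1⟩, hzU⟩, rfl⟩

/-! ### Complex conjugation and the polar loci -/

/-- Complex conjugation of the coefficients of a polynomial. -/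
noncomputable def conjPoly (n : ℕ) : MvPolynomial (Fin n) ℂ ≃+* MvPolynomial (Fin n) ℂ :=
  mapEquiv (Fin n) (starRingAut (R := ℂ))

lemma eval_star_conjPoly {n : ℕ} (z : Fin n → ℂ) (p : MvPolynomial (Fin n) ℂ) :
    eval (star z) (conjPoly n p) = star (eval z p) := by
  induction p using MvPolynomial.induction_on with
  | C a => simp [conjPoly]
  | add p q hp hq => simp [hp, hq]
  | mul_X p k hp => rw [map_mul, map_mul, hp]; simp [conjPoly]

lemma conjPoly_conjPoly {n : ℕ} (p : MvPolynomial (Fin n) ℂ) : conjPoly n (conjPoly n p) = p := by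
  induction p using MvPolynomial.induction_on with
  | C a => simp [conjPoly]
  | add p q hp hq => simp [hp, hq]
  | mul_X p k hp => rw [map_mul, map_mul, hp]; simp [conjPoly]

lemma pderiv_conjPoly {n : ℕ} (k : Fin n) (p : MvPolynomial (Fin n) ℂ) :
    pderiv k (conjPoly n p) = conjPoly n (pderiv k p) := by
  simp [conjPoly, pderiv_map]

/-- A set of points of `ℂⁿ` stable under complex conjugation. -/
def ConjInvariant {n : ℕ} (W : Set (Fin n → ℂ)) : Prop := ∀ z ∈ W, star z ∈ W

lemma ConjInvariant.conjPoly_mem {n : ℕ} {W : Set (Fin n → ℂ)} (hW : ConjInvariant W)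
    {p : MvPolynomial (Fin n) ℂ} (hp : p ∈ idealOf W) : conjPoly n p ∈ idealOf W := by
  intro z hz
  have h := hp _ (hW z hz)
  rw [aeval_eq_eval] at h ⊢
  change eval z _ = 0
  have := eval_star_conjPoly (star z) p
  rw [star_star] at this
  rw [this, show eval (star z) p = 0 from h, star_zero]

lemma ConjInvariant.conjPoly_mem_iff {n : ℕ} {W : Set (Fin n → ℂ)} (hW : ConjInvariant W)
    {p : MvPolynomial (Fin n) ℂ} : conjPoly n p ∈ idealOf W ↔ p ∈ idealOf W :=
  ⟨fun h => by simpa [conjPoly_conjPoly] using hW.conjPoly_mem h, hW.conjPoly_mem⟩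

lemma star_mem_zeroLocus_comap {n : ℕ} {I : Ideal (MvPolynomial (Fin n) ℂ)} {z : Fin n → ℂ}
    (hz : z ∈ zeroLocus ℂ I) : star z ∈ zeroLocus ℂ (I.comap (conjPoly n)) := by
  intro p hp
  have h := hz _ hp
  rw [aeval_eq_eval] at h ⊢
  have := eval_star_conjPoly z (conjPoly n p)
  rw [conjPoly_conjPoly] at this
  exact this.trans (by rw [show eval z (conjPoly n p) = 0 from h, star_zero])

lemma ConjInvariant.comap_idealOf {n : ℕ} {W : Set (Fin n → ℂ)} (hW : ConjInvariant W) :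
    (idealOf W).comap (conjPoly n) = idealOf W :=
  Ideal.ext fun _ => hW.conjPoly_mem_iff

lemma ConjInvariant.zariskiClosure {n : ℕ} {W : Set (Fin n → ℂ)} (hW : ConjInvariant W) :
    ConjInvariant (zariskiClosure W) := fun z hz => by
  have := star_mem_zeroLocus_comap hz
  rwa [hW.comap_idealOf] at this

lemma ConjInvariant.union {n : ℕ} {V W : Set (Fin n → ℂ)} (hV : ConjInvariant V)
    (hW : ConjInvariant W) : ConjInvariant (V ∪ W) :=
  fun z hz => hz.imp (hV z) (hW z)

lemma ConjInvariant.equidimComp {n : ℕ} {W : Set (Fin n → ℂ)} (hW : ConjInvariant W) (r : ℕ) :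
    ConjInvariant (equidimComp r W) := by
  rintro z ⟨P, hP, hr, hz⟩
  refine ⟨P.comap (conjPoly n), ?_, ?_, star_mem_zeroLocus_comap hz⟩
  · have := Ideal.comap_minimalPrimes_eq_of_surjective
      (f := (conjPoly n : MvPolynomial (Fin n) ℂ →+* MvPolynomial (Fin n) ℂ))
      (conjPoly n).surjective (I := idealOf W)
    have h2 : (idealOf W).comap (conjPoly n : _ →+* _) = idealOf W := hW.comap_idealOf
    rw [h2] at this
    rw [this]
    exact ⟨P, hP, rfl⟩
  · rw [← hr]
    refine ringKrullDim_eq_of_ringEquiv (Ideal.quotientEquiv _ _ (conjPoly n) ?_)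
    exact (Ideal.map_comap_of_surjective _ (conjPoly n).surjective P).symm

/-- The truncated gradients at `x` of the elements of `I(W)`, which form a subspace. -/
noncomputable def gradSpace {n : ℕ} (i : ℕ) (W : Set (Fin n → ℂ)) (x : Fin n → ℂ) :
    Submodule ℂ (Fin n → ℂ) where
  carrier := {w | ∃ f ∈ idealOf W,
    w = fun k : Fin n => if (k : ℕ) < i then 0 else eval x (pderiv k f)}
  zero_mem' := ⟨0, zero_mem _, by ext; simp⟩
  add_mem' := by
    rintro _ _ ⟨f, hf, rfl⟩ ⟨g, hg, rfl⟩
    refine ⟨f + g, add_mem hf hg, ?_⟩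
    ext k
    by_cases hk : (k : ℕ) < i <;> simp [hk]
  smul_mem' := by
    rintro c _ ⟨f, hf, rfl⟩
    refine ⟨C c * f, Ideal.mul_mem_left _ _ hf, ?_⟩
    ext k
    by_cases hk : (k : ℕ) < i <;> simp [hk]

lemma jacRank_eq {n : ℕ} (i : ℕ) (W : Set (Fin n → ℂ)) (x : Fin n → ℂ) :
    jacRank i W x = Module.finrank ℂ (gradSpace i W x) := by
  rw [jacRank, show {w : Fin n → ℂ | ∃ f ∈ idealOf W,
    w = fun k : Fin n => if (k : ℕ) < i then 0 else eval x (pderiv k f)} = gradSpace i W x from rfl,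
    Submodule.span_eq]

lemma ConjInvariant.star_mem_gradSpace {n i : ℕ} {W : Set (Fin n → ℂ)} (hW : ConjInvariant W)
    {x w : Fin n → ℂ} (hw : w ∈ gradSpace i W x) : star w ∈ gradSpace i W (star x) := by
  obtain ⟨f, hf, rfl⟩ := hw
  refine ⟨conjPoly n f, hW.conjPoly_mem hf, ?_⟩
  ext k
  by_cases hk : (k : ℕ) < i
  · simp [hk]
  · simp only [Pi.star_apply, hk, if_false, pderiv_conjPoly, eval_star_conjPoly]

lemma ConjInvariant.jacRank_star {n : ℕ} {W : Set (Fin n → ℂ)} (hW : ConjInvariant W) (i : ℕ)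
    (x : Fin n → ℂ) : jacRank i W (star x) = jacRank i W x := by
  rw [jacRank_eq, jacRank_eq, Module.finrank, Module.finrank]
  congr 1
  let j : gradSpace i W (star x) ≃+ gradSpace i W x :=
    { toFun := fun w => ⟨star w.1, by simpa using hW.star_mem_gradSpace w.2⟩
      invFun := fun w => ⟨star w.1, hW.star_mem_gradSpace w.2⟩
      left_inv := fun w => by simp
      right_inv := fun w => by simp
      map_add' := fun v w => by ext; simp }
  exact rank_eq_of_equiv_equiv (starRingEnd ℂ) j (starRingAut (R := ℂ)).bijective
    fun c w => by ext; simp [j]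

lemma ConjInvariant.singLocus {n : ℕ} {W : Set (Fin n → ℂ)} (hW : ConjInvariant W) :
    ConjInvariant (singLocus W) := by
  rintro z ⟨d, hd, h⟩
  refine ⟨d, hd, h.imp (fun ⟨r, hr, hz⟩ => ⟨r, hr, hW.equidimComp r z hz⟩) fun ⟨hz, hj⟩ => ?_⟩
  exact ⟨hW.equidimComp d z hz, by rwa [(hW.equidimComp d).jacRank_star]⟩

lemma ConjInvariant.critLocus {n : ℕ} {W : Set (Fin n → ℂ)} (hW : ConjInvariant W) (i : ℕ) :
    ConjInvariant (critLocus i W) := by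
  refine ConjInvariant.zariskiClosure fun z hz => ?_
  refine hz.imp (fun ⟨r, hr, hz⟩ => ⟨r, hr, hW.equidimComp r z hz⟩) ?_
  rintro ⟨r, hr, ⟨hz, hj⟩, hc⟩
  have h := hW.equidimComp r
  exact ⟨r, hr, ⟨h z hz, by rwa [h.jacRank_star]⟩, by rwa [h.jacRank_star]⟩

lemma ConjInvariant.polarAux {n : ℕ} {V : Set (Fin n → ℂ)} (hV : ConjInvariant V) (d k : ℕ) :
    ConjInvariant (polarAux d V k) := by
  induction k with
  | zero => exact hV
  | succ k ih => exact (ih.singLocus.union (ih.critLocus _)).union (hV.critLocus _)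

lemma conjInvariant_of_isAlgebraicOver_real {n : ℕ} {V : Set (Fin n → ℂ)}
    (hV : IsAlgebraicOver ℝ V) : ConjInvariant V := by
  obtain ⟨I, rfl⟩ := hV
  intro z hz p hp
  have h := hz p hp
  rw [show star z = fun k => Complex.conjAe (z k) from rfl]
  have : aeval (fun k => Complex.conjAe (z k)) p = Complex.conjAe (aeval z p) := by
    rw [← AlgEquiv.coe_toAlgHom, ← comp_aeval_apply]
  rw [this, h, map_zero]

lemma subset_zariskiClosure {n : ℕ} (W : Set (Fin n → ℂ)) : W ⊆ zariskiClosure W :=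
  zeroLocus_vanishingIdeal_le W

lemma zariskiClosure_subset_of_isAlgebraicOver {k : Type} [Field k] [Algebra k ℂ] {n : ℕ}
    {V W : Set (Fin n → ℂ)} (hV : IsAlgebraicOver k V) (h : W ⊆ V) : zariskiClosure W ⊆ V := by
  obtain ⟨I, rfl⟩ := hV
  intro z hz p hp
  have hmem : map (algebraMap k ℂ) p ∈ idealOf W := fun w hw => by
    rw [aeval_map_algebraMap]
    exact h hw p hp
  have := hz _ hmem
  rwa [aeval_map_algebraMap] at this

lemma isAlgebraicOver_zariskiClosure {n : ℕ} (W : Set (Fin n → ℂ)) :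
    IsAlgebraicOver ℂ (zariskiClosure W) := ⟨idealOf W, rfl⟩

lemma equidimComp_subset {n : ℕ} (r : ℕ) (W : Set (Fin n → ℂ)) :
    equidimComp r W ⊆ zariskiClosure W := by
  rintro z ⟨P, hP, -, hz⟩
  exact zeroLocus_anti_mono hP.1.2 hz

lemma singLocus_subset {n : ℕ} (W : Set (Fin n → ℂ)) : singLocus W ⊆ zariskiClosure W := by
  rintro z ⟨d, -, ⟨r, -, hz⟩ | ⟨hz, -⟩⟩ <;> exact equidimComp_subset _ W hz

lemma critLocus_subset {n : ℕ} (i : ℕ) (W : Set (Fin n → ℂ)) :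
    critLocus i W ⊆ zariskiClosure W := by
  refine zariskiClosure_subset_of_isAlgebraicOver (isAlgebraicOver_zariskiClosure W) ?_
  rintro z (⟨r, -, hz⟩ | ⟨r, -, ⟨hz, -⟩, -⟩) <;> exact equidimComp_subset _ W hz

/-- Both loci in the recursion depend on a set only through its ideal, so that the sets `𝒪_i(V)`
stay inside an algebraic `V` even though they are not shown to be closed. -/
lemma polarAux_subset {k : Type} [Field k] [Algebra k ℂ] {n : ℕ} {V : Set (Fin n → ℂ)}
    (hV : IsAlgebraicOver k V) (d j : ℕ) : polarAux d V j ⊆ V := by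
  induction j with
  | zero => exact subset_rfl
  | succ j ih =>
    have h1 := zariskiClosure_subset_of_isAlgebraicOver hV ih
    have h2 := zariskiClosure_subset_of_isAlgebraicOver hV (subset_refl V)
    exact Set.union_subset (Set.union_subset ((singLocus_subset _).trans h1)
      ((critLocus_subset _ _).trans h1)) ((critLocus_subset _ _).trans h2)

/-! ### Regular real points -/

lemma hasStrictFDerivAt_eval {n : ℕ} (p : MvPolynomial (Fin n) ℂ) (x : Fin n → ℂ) :
    HasStrictFDerivAt (fun z => eval z p)
      (∑ k, eval x (pderiv k p) • ContinuousLinearMap.proj (R := ℂ) (φ := fun _ : Fin n => ℂ) k)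
      x := by
  induction p using MvPolynomial.induction_on with
  | C a =>
    have h : HasStrictFDerivAt (fun z : Fin n → ℂ => eval z (C a)) (0 : (Fin n → ℂ) →L[ℂ] ℂ) x := by
      simpa only [eval_C] using hasStrictFDerivAt_const a x
    refine h.congr_fderiv ?_
    ext v
    simp [sum_apply]
  | add p q hp hq =>
    have h := hp.fun_add hq
    simp only [← map_add] at h
    refine h.congr_fderiv ?_
    ext v
    simp [sum_apply, add_mul, Finset.sum_add_distrib]
  | mul_X p k hp =>
    have hX : HasStrictFDerivAt (fun z : Fin n → ℂ => eval z (X k))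
        (ContinuousLinearMap.proj (R := ℂ) (φ := fun _ : Fin n => ℂ) k) x := by
      simp only [eval_X]
      exact (ContinuousLinearMap.proj (R := ℂ) (φ := fun _ : Fin n => ℂ) k).hasStrictFDerivAt
    have h := hp.fun_mul hX
    simp only [← map_mul] at h
    refine h.congr_fderiv ?_
    ext v
    simp [sum_apply, pderiv_X, Pi.single_apply, add_mul, Finset.sum_add_distrib, Finset.mul_sum,
      apply_ite (eval x), mul_assoc]

lemma card_low {n i : ℕ} (hi : i ≤ n) : Fintype.card (Low n i) = i := by
  have e : Low n i ≃ Fin i :=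
    { toFun := fun k => ⟨k.1, k.2⟩
      invFun := fun k => ⟨⟨k, k.2.trans_le hi⟩, k.2⟩
      left_inv := fun _ => rfl
      right_inv := fun _ => rfl }
  simpa using Fintype.card_congr e

/-- If the truncated gradients of `I(W)` at `x` have the maximal possible rank `n - i`, they contain
the unit vectors in the remaining directions. -/
lemma exists_grad_eq_single {n i : ℕ} {W : Set (Fin n → ℂ)} {x : Fin n → ℂ} (hi : i ≤ n)
    (h : n ≤ jacRank i W x + i) (k : Fin n) (hk : ¬ (k : ℕ) < i) :
    ∃ f ∈ idealOf W, ∀ j : Fin n, ¬ (j : ℕ) < i →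
      eval x (pderiv j f) = if j = k then 1 else 0 := by
  let ρ : (Fin n → ℂ) →ₗ[ℂ] (Low n i → ℂ) := LinearMap.funLeft ℂ ℂ Subtype.val
  have hρ : Function.Surjective ρ :=
    LinearMap.funLeft_surjective_of_injective _ _ _ Subtype.val_injective
  have hle : gradSpace i W x ≤ LinearMap.ker ρ := by
    rintro _ ⟨f, -, rfl⟩
    ext j
    simp [ρ, LinearMap.funLeft_apply, j.2]
  have hrank := ρ.finrank_range_add_finrank_ker
  rw [LinearMap.range_eq_top.2 hρ, finrank_top, Module.finrank_fintype_fun_eq_card,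
    Module.finrank_fintype_fun_eq_card, card_low hi, Fintype.card_fin] at hrank
  have heq : gradSpace i W x = LinearMap.ker ρ := by
    refine Submodule.eq_of_le_of_finrank_le hle ?_
    rw [jacRank_eq] at h
    omega
  have hmem : Pi.single k (1 : ℂ) ∈ gradSpace i W x := by
    rw [heq, LinearMap.mem_ker]
    ext j
    have : j.1 ≠ k := fun h => hk (h ▸ j.2)
    simp [ρ, LinearMap.funLeft_apply, this]
  obtain ⟨f, hf, hfk⟩ := hmem
  refine ⟨f, hf, fun j hj => ?_⟩
  have := congrFun hfk j
  rw [if_neg hj, Pi.single_apply] at this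
  exact this.symm

/-- At a point where the truncated Jacobian of `I(W)` has rank `n - i`, some polynomials
of `I(W)` complete the first `i` coordinates to a local coordinate system. -/
lemma exists_local_coordinates {n i : ℕ} {W : Set (Fin n → ℂ)} {x : Fin n → ℂ} (hi : i ≤ n)
    (h : n ≤ jacRank i W x + i) :
    ∃ Φ : OpenPartialHomeomorph (Fin n → ℂ) (Fin n → ℂ), x ∈ Φ.source ∧
      ∀ z ∈ W, Φ z = fun k : Fin n => if (k : ℕ) < i then z k else 0 := by
  choose f hf hfk using exists_grad_eq_single hi h
  let F (z : Fin n → ℂ) (k : Fin n) : ℂ := if hk : (k : ℕ) < i then z k else eval z (f k hk)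
  let D (k : Fin n) : (Fin n → ℂ) →L[ℂ] ℂ :=
    if hk : (k : ℕ) < i then ContinuousLinearMap.proj k
    else ∑ j, eval x (pderiv j (f k hk)) • ContinuousLinearMap.proj j
  have hF : HasStrictFDerivAt F (ContinuousLinearMap.pi D) x := by
    refine hasStrictFDerivAt_pi.2 fun k => ?_
    by_cases hk : (k : ℕ) < i
    · simp only [D, hk, dif_pos]
      exact (ContinuousLinearMap.proj (R := ℂ) (φ := fun _ : Fin n => ℂ) k).hasStrictFDerivAt
    · simp only [D, hk, dif_neg, not_false_eq_true]
      exact hasStrictFDerivAt_eval _ _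
  have hinj : Function.Injective (ContinuousLinearMap.pi D : (Fin n → ℂ) →ₗ[ℂ] (Fin n → ℂ)) := by
    rw [← LinearMap.ker_eq_bot, LinearMap.ker_eq_bot']
    intro v hv
    have hv' (k : Fin n) : D k v = 0 := congrFun hv k
    have hlow (k : Fin n) (hk : (k : ℕ) < i) : v k = 0 := by
      simpa [D, hk] using hv' k
    ext k
    by_cases hk : (k : ℕ) < i
    · exact hlow k hk
    · have h1 := hv' k
      simp only [D, hk, dif_neg, not_false_eq_true, sum_apply,
        smul_apply, ContinuousLinearMap.proj_apply, smul_eq_mul] at h1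
      rw [Finset.sum_eq_single k] at h1
      · simpa [hfk k hk k hk] using h1
      · intro j _ hjk
        by_cases hj : (j : ℕ) < i
        · rw [hlow j hj, mul_zero]
        · rw [hfk k hk j hj, if_neg hjk, zero_mul]
      · simp
  let e := (LinearEquiv.ofInjectiveEndo _ hinj).toContinuousLinearEquiv
  have he : (e : (Fin n → ℂ) →L[ℂ] (Fin n → ℂ)) = ContinuousLinearMap.pi D := by
    ext v k; rfl
  rw [← he] at hF
  refine ⟨hF.toOpenPartialHomeomorph F, hF.mem_toOpenPartialHomeomorph_source, fun z hz => ?_⟩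
  rw [hF.toOpenPartialHomeomorph_coe]
  ext k
  by_cases hk : (k : ℕ) < i
  · simp [F, hk]
  · simpa [F, hk, aeval_eq_eval] using hf k hk z hz

lemma star_toComplex {n : ℕ} (y : Fin n → ℝ) : star (toComplex y) = toComplex y := by
  ext k; simp [toComplex]

lemma continuous_toComplex {n : ℕ} : Continuous (toComplex : (Fin n → ℝ) → Fin n → ℂ) := by
  unfold toComplex; fun_prop

/-- A point outside the singular and critical loci lies on an irreducible component of
dimension `i`, and the Jacobian of the `i`-dimensional part has rank `n - i` there, even after
deletion of its first `i` columns. -/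
lemma exists_component_of_notMem {n i : ℕ} {W : Set (Fin n → ℂ)} (hdim : algDim W ≤ i)
    {x : Fin n → ℂ} (hx : x ∈ zariskiClosure W) (hsing : x ∉ singLocus W)
    (hcrit : x ∉ critLocus i W) :
    ∃ P ∈ (idealOf W).minimalPrimes, x ∈ zeroLocus ℂ P ∧
      ringKrullDim (MvPolynomial (Fin n) ℂ ⧸ P) = i ∧ i ≤ n ∧
      n ≤ jacRank i (equidimComp i W) x + i := by
  have hle : idealOf W ≤ vanishingIdeal ℂ {x} := fun p hp => by
    simpa using hx p hp
  obtain ⟨P, hP, hPx⟩ := Ideal.exists_minimalPrimes_le hle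
  have hxP : x ∈ zeroLocus ℂ P := fun p hp => by simpa using hPx hp
  have := hP.1.1
  have hPW : ringKrullDim (MvPolynomial (Fin n) ℂ ⧸ P) ≤ algDim W :=
    ringKrullDim_le_of_surjective _ (Ideal.Quotient.factor_surjective hP.1.2)
  obtain ⟨r, hr⟩ : ∃ r : ℕ, ringKrullDim (MvPolynomial (Fin n) ℂ ⧸ P) = r := by
    have h0 := ringKrullDim_nonneg_of_nontrivial (R := MvPolynomial (Fin n) ℂ ⧸ P)
    have h1 := hPW.trans hdim
    generalize ringKrullDim (MvPolynomial (Fin n) ℂ ⧸ P) = a at h0 h1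
    induction a using WithBot.recBotCoe with
    | bot => simp at h0
    | coe a =>
      have h1 : a ≤ (i : ℕ∞) := by exact_mod_cast h1
      lift a to ℕ using ne_top_of_le_ne_top (ENat.natCast_ne_top i) h1
      exact ⟨a, rfl⟩
  have hri : r = i := by
    have h1 : r ≤ i := by
      have := hPW.trans hdim
      rw [hr] at this
      exact_mod_cast this
    refine h1.antisymm (not_lt.1 fun hlt => hcrit ?_)
    exact subset_zariskiClosure _ (Or.inl ⟨r, hlt, P, hP, hr, hxP⟩)
  subst hri
  have hdimW : algDim W = r := hdim.antisymm (hr ▸ hPW)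
  have hxW : x ∈ equidimComp r W := ⟨P, hP, hr, hxP⟩
  have hreg : jacRank 0 (equidimComp r W) x + r = n := by
    by_contra h
    exact hsing ⟨r, hdimW, Or.inr ⟨hxW, h⟩⟩
  refine ⟨P, hP, hxP, hr, by omega, not_lt.1 fun h => hcrit ?_⟩
  exact subset_zariskiClosure _ (Or.inr ⟨r, le_rfl, ⟨hxW, hreg⟩, h⟩)

/-- Near a real point outside its singular and critical loci, a conjugation invariant set in
Noether position contains the graph of a continuous real function of the first `i` coordinates.
Local injectivity of the coordinates forces the complex points over real ones to be real. -/
lemma eventually_exists_mem_component {n i : ℕ} {W : Set (Fin n → ℂ)} (hW : ConjInvariant W)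
    (hdim : algDim W ≤ i) (hN : IsNoetherPosition i W) {x : Fin n → ℝ}
    (hx : toComplex x ∈ zariskiClosure W) (hsing : toComplex x ∉ singLocus W)
    (hcrit : toComplex x ∉ critLocus i W) {S : Set (Fin n → ℝ)}
    (hS : realPoints (zariskiClosure W) ⊆ S) :
    ∀ᶠ y in 𝓝 x, ∃ c ∈ connectedComponentIn S x, ∀ k : Fin n, (k : ℕ) < i → c k = y k := by
  obtain ⟨P, hP, hxP, hPdim, hi, hrank⟩ := exists_component_of_notMem hdim hx hsing hcrit
  have := hP.1.1
  have hPN : (lowMap i P).IsIntegral := lowMap_isIntegral_mono hP.1.2 hN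
  obtain ⟨Φ, hxΦ, hΦ⟩ := exists_local_coordinates hi hrank
  have hPW : zeroLocus ℂ P ⊆ equidimComp i W := fun z hz => ⟨P, hP, hPdim, hz⟩
  have hU : Φ.source ∩ star ⁻¹' Φ.source ∈ 𝓝 (toComplex x) := by
    refine inter_mem (Φ.open_source.mem_nhds hxΦ)
      ((Φ.open_source.preimage continuous_star).mem_nhds ?_)
    rwa [Set.mem_preimage, star_toComplex]
  have hproj : Continuous fun y : Fin n → ℝ => proj i (toComplex y) := by
    unfold proj toComplex; fun_prop
  have hev := hproj.continuousAt.eventually (projection_open hPN hPdim.ge hxP hU)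
  let G (y : Fin n → ℝ) (k : Fin n) : ℂ := if (k : ℕ) < i then (y k : ℂ) else 0
  have hG : Continuous G := continuous_pi fun k => by
    by_cases hk : (k : ℕ) < i <;> simp only [G, hk, if_true, if_false] <;> fun_prop
  have hΦG {z : Fin n → ℂ} (hz : z ∈ equidimComp i W) {y : Fin n → ℝ}
      (hzy : proj i z = proj i (toComplex y)) : Φ z = G y := by
    rw [hΦ z hz]
    ext k
    by_cases hk : (k : ℕ) < i
    · simpa [G, hk, proj, toComplex] using congrFun hzy ⟨k, hk⟩
    · simp [G, hk]
  -- over a real point, the local inverse takes real values lying on `W`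
  have hmain {y : Fin n → ℝ} (hy : ∃ z ∈ zeroLocus ℂ P, proj i z = proj i (toComplex y) ∧
      z ∈ Φ.source ∩ star ⁻¹' Φ.source) :
      G y ∈ Φ.target ∧ (∀ k : Fin n, (k : ℕ) < i → (Φ.symm (G y) k).re = y k) ∧
        (fun k => (Φ.symm (G y) k).re) ∈ S := by
    obtain ⟨z, hz, hzy, hzU⟩ := hy
    have h1 := hΦG (hPW hz) hzy
    have h2 : Φ (star z) = G y := hΦG (hW.equidimComp i z (hPW hz)) (by
      ext k
      have := congrFun hzy k
      simp only [proj, toComplex] at this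
      simp [proj, toComplex, this])
    have hstar : star z = z := Φ.injOn hzU.2 hzU.1 (h2.trans h1.symm)
    have hsymm : Φ.symm (G y) = z := by rw [← h1, Φ.left_inv hzU.1]
    have hre : toComplex (fun k => (z k).re) = z := by
      ext k
      exact Complex.conj_eq_iff_re.1 (congrFun hstar k)
    refine ⟨h1 ▸ Φ.map_source hzU.1, fun k hk => ?_, ?_⟩
    · rw [hsymm]
      have : z k = y k := congrFun hzy ⟨k, hk⟩
      simp [this]
    · rw [hsymm]
      refine hS ?_
      change toComplex _ ∈ zariskiClosure W
      rw [hre]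
      exact equidimComp_subset i W (hPW hz)
  obtain ⟨ε, hε, hball⟩ := Metric.mem_nhds_iff.1 hev
  have hcont : ContinuousOn (fun (y : Fin n → ℝ) k => (Φ.symm (G y) k).re) (Metric.ball x ε) := by
    have : ContinuousOn (fun y => Φ.symm (G y)) (Metric.ball x ε) :=
      Φ.continuousOn_symm.comp hG.continuousOn fun y hy => (hmain (hball hy)).1
    exact continuousOn_pi.2 fun k =>
      Complex.continuous_re.comp_continuousOn (continuousOn_pi.1 this k)
  have hconn := (convex_ball x ε).isPreconnected.image _ hcont
  have hxfix : (fun k => (Φ.symm (G x) k).re) = x := by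
    have h1 := hΦG (hPW hxP) (y := x) rfl
    rw [← h1, Φ.left_inv hxΦ]
    ext k
    simp [toComplex]
  have hsub := hconn.subset_connectedComponentIn (F := S) (x := x)
    ⟨x, Metric.mem_ball_self hε, hxfix⟩ (by
      rintro _ ⟨y, hy, rfl⟩
      exact (hmain (hball hy)).2.2)
  filter_upwards [Metric.ball_mem_nhds x hε] with y hy
  exact ⟨_, hsub ⟨y, hy, rfl⟩, (hmain (hball hy)).2.1⟩

/-! ### Projections of a connected component -/

/-- The projection of `ℝⁿ` onto the first `i` coordinates. -/
def realProj (n i : ℕ) : (Fin n → ℝ) →ₗ[ℝ] (Low n i → ℝ) := LinearMap.funLeft ℝ ℝ Subtype.val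

lemma continuous_realProj (n i : ℕ) : Continuous (realProj n i) :=
  LinearMap.continuous_of_finiteDimensional _

lemma isOpenMap_realProj (n i : ℕ) : IsOpenMap (realProj n i) :=
  LinearMap.isOpenMap_of_finiteDimensional _
    (LinearMap.funLeft_surjective_of_injective _ _ _ Subtype.val_injective)

lemma realProj_eq_iff {n i : ℕ} {x y : Fin n → ℝ} :
    realProj n i x = realProj n i y ↔ ∀ k : Fin n, (k : ℕ) < i → x k = y k := by
  simp [realProj, funext_iff, LinearMap.funLeft_apply]

/-- The cylinder `π_i⁻¹(π_i(C))` in `ℝⁿ`. Working with cylinders keeps the images `π_i(C)` for all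
`i` inside one space. -/
def cylinder {n : ℕ} (i : ℕ) (C : Set (Fin n → ℝ)) : Set (Fin n → ℝ) :=
  realProj n i ⁻¹' (realProj n i '' C)

lemma mem_cylinder {n i : ℕ} {C : Set (Fin n → ℝ)} {y : Fin n → ℝ} :
    y ∈ cylinder i C ↔ ∃ c ∈ C, ∀ k : Fin n, (k : ℕ) < i → c k = y k := by
  simp [cylinder, realProj_eq_iff]

lemma cylinder_anti {n : ℕ} (C : Set (Fin n → ℝ)) {i j : ℕ} (h : i ≤ j) :
    cylinder j C ⊆ cylinder i C := fun y hy => by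
  rw [mem_cylinder] at hy ⊢
  obtain ⟨c, hc, hcy⟩ := hy
  exact ⟨c, hc, fun k hk => hcy k (hk.trans_le h)⟩

lemma mem_interior_cylinder_congr {n i : ℕ} {C : Set (Fin n → ℝ)} {x y : Fin n → ℝ}
    (h : realProj n i x = realProj n i y) :
    x ∈ interior (cylinder i C) ↔ y ∈ interior (cylinder i C) := by
  rw [cylinder, ← (isOpenMap_realProj n i).preimage_interior_eq_interior_preimage
    (continuous_realProj n i), Set.mem_preimage, Set.mem_preimage, h]

lemma IsNoetherPosition.mono {n i j : ℕ} (h : i ≤ j) {W : Set (Fin n → ℂ)}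
    (hW : IsNoetherPosition i W) : IsNoetherPosition j W := by
  let ι : MvPolynomial (Low n i) ℂ →+* MvPolynomial (Low n j) ℂ :=
    (rename (R := ℂ) fun k : Low n i => (⟨k.1, k.2.trans_le h⟩ : Low n j)).toRingHom
  have : lowMap i (idealOf W) = (lowMap j (idealOf W)).comp ι := by
    ext k <;> simp [lowMap, ι]
  refine RingHom.IsIntegral.tower_top ι (lowMap j (idealOf W)) ?_
  rw [← this]
  exact hW

/-- Properness over a set in Noether position: a point that is approached by the projections of
points of `C` on that set is itself the projection of a point of `C`. -/
lemma mem_cylinder_of_mem_closure {n i : ℕ} {W : Set (Fin n → ℂ)} (hN : IsNoetherPosition i W)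
    {C : Set (Fin n → ℝ)} (hC : IsClosed C) {t : Fin n → ℝ}
    (ht : realProj n i t ∈
      closure (realProj n i '' (C ∩ realPoints (zariskiClosure W)))) : t ∈ cylinder i C := by
  obtain ⟨B, hB⟩ := exists_bound_of_isIntegral hN
    (isCompact_closedBall (proj i (toComplex t)) 1)
  have hcpt : IsCompact (C ∩ Metric.closedBall 0 B) :=
    (isCompact_closedBall _ _).inter_left hC
  have himg := (hcpt.image (continuous_realProj n i)).isClosed
  have h1 := Metric.isOpen_ball.inter_closure ⟨Metric.mem_ball_self one_pos, ht⟩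
  have h2 : realProj n i t ∈ realProj n i '' (C ∩ Metric.closedBall 0 B) := by
    refine closure_minimal ?_ himg h1
    rintro _ ⟨hball, c, ⟨hc, hcW⟩, rfl⟩
    refine ⟨c, ⟨hc, ?_⟩, rfl⟩
    have hn : ‖toComplex c‖ ≤ B := by
      refine hB _ hcW ?_
      rw [Metric.mem_closedBall, dist_pi_le_iff zero_le_one]
      intro k
      rw [Metric.mem_ball, dist_pi_lt_iff one_pos] at hball
      have := (hball k).le
      rw [Real.dist_eq] at this
      simp only [proj, toComplex, dist_eq_norm]
      rwa [← Complex.ofReal_sub, Complex.norm_real]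
    have hB0 : 0 ≤ B := (norm_nonneg _).trans hn
    rw [mem_closedBall_zero_iff, pi_norm_le_iff_of_nonneg hB0]
    intro k
    have := (norm_le_pi_norm (toComplex c) k).trans hn
    rwa [toComplex, Complex.norm_real] at this
  exact Set.image_mono Set.inter_subset_left h2

/-- Descent of closedness from `π_{i+1}(C)` to `π_i(C)`. Where the points of `C` over the boundary
of `π_{i+1}(C)` do not accumulate, `π_{i+1}(C)` contains whole lines over `π_i(C)`, and the two
cylinders agree. -/
lemma isClosed_cylinder_of_succ {n i : ℕ} {W : Set (Fin n → ℂ)} (hN : IsNoetherPosition i W)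
    {C : Set (Fin n → ℝ)} (hC : IsClosed C) (hcl : IsClosed (cylinder (i + 1) C))
    (hb : ∀ x ∈ C, x ∉ interior (cylinder (i + 1) C) → toComplex x ∈ zariskiClosure W) :
    IsClosed (cylinder i C) := by
  refine isClosed_of_closure_subset fun t ht => ?_
  by_cases hacc : realProj n i t ∈
      closure (realProj n i '' (C ∩ realPoints (zariskiClosure W)))
  · exact mem_cylinder_of_mem_closure hN hC hacc
  have hopen : IsOpen (realProj n i ⁻¹'
      (closure (realProj n i '' (C ∩ realPoints (zariskiClosure W))))ᶜ) :=
    isClosed_closure.isOpen_compl.preimage (continuous_realProj n i)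
  refine cylinder_anti C i.le_succ (closure_minimal ?_ hcl (hopen.inter_closure ⟨hacc, ht⟩))
  rintro y ⟨hy, hyC⟩
  obtain ⟨c, hc, hcy⟩ := mem_cylinder.1 hyC
  rcases le_or_gt n i with hni | hin
  · exact mem_cylinder.2 ⟨c, hc, fun k _ => hcy k (k.2.trans_le hni)⟩
  let k₀ : Fin n := ⟨i, hin⟩
  let u (s : ℝ) : Fin n → ℝ := Function.update y k₀ s
  have hu : Continuous u := continuous_const.update k₀ continuous_id
  have hulow (s : ℝ) (k : Fin n) (hk : (k : ℕ) < i) : u s k = y k := by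
    have : k ≠ k₀ := by rintro rfl; exact lt_irrefl _ hk
    simp [u, this]
  have hAopen : IsOpen (u ⁻¹' cylinder (i + 1) C) := by
    rw [← subset_interior_iff_isOpen]
    intro s hs
    by_contra hsint
    obtain ⟨c', hc', hcu⟩ := mem_cylinder.1 hs
    have hnot : c' ∉ interior (cylinder (i + 1) C) := by
      rw [mem_interior_cylinder_congr (realProj_eq_iff.2 hcu)]
      exact fun h => hsint (preimage_interior_subset_interior_preimage hu h)
    refine hy (subset_closure ⟨c', ⟨hc', hb c' hc' hnot⟩, ?_⟩)
    rw [realProj_eq_iff]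
    exact fun k hk => (hcu k (hk.trans i.lt_succ_self)).trans (hulow s k hk)
  have huniv : u ⁻¹' cylinder (i + 1) C = Set.univ := by
    refine IsClopen.eq_univ ⟨hcl.preimage hu, hAopen⟩ ⟨c k₀, ?_⟩
    refine mem_cylinder.2 ⟨c, hc, fun k hk => ?_⟩
    rcases (Nat.lt_succ_iff_lt_or_eq.1 hk) with hk | hk
    · rw [hulow _ k hk, hcy k hk]
    · obtain rfl : k = k₀ := Fin.ext hk
      simp [u]
  have : y k₀ ∈ u ⁻¹' cylinder (i + 1) C := huniv ▸ Set.mem_univ _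
  simpa [u] using this

/-- The descent along the polar varieties: the images `π_{d-j+1}(C)` are closed, and the points
of `C` over the boundary of `π_{d-j+1}(C)` lie on `𝒪_{d-j}(V)`. -/
lemma isClosed_cylinder_and_mem_polarAux {n d : ℕ} {V : Set (Fin n → ℂ)}
    (hV : IsAlgebraicOver ℝ V)
    (hP : ∀ i ≤ d, algDim (polar d V i) ≤ i ∧ IsNoetherPosition i (polar d V i))
    {C : Set (Fin n → ℝ)} (hC : IsClosed C) (hCV : C ⊆ realPoints V)
    (hconn : ∀ x ∈ C, connectedComponentIn (realPoints V) x ⊆ C) (j : ℕ) (hj : j ≤ d) :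
    IsClosed (cylinder (d - j + 1) C) ∧
      ∀ x ∈ C, x ∉ interior (cylinder (d - j + 1) C) → toComplex x ∈ polarAux d V j := by
  induction j with
  | zero =>
    refine ⟨isClosed_of_closure_subset fun t ht => ?_, fun x hx _ => hCV hx⟩
    have hN : IsNoetherPosition d V := by simpa [polar, polarAux] using (hP d le_rfl).2
    refine mem_cylinder_of_mem_closure (hN.mono (Nat.le_succ d)) hC ?_
    have hCV' : C ∩ realPoints (zariskiClosure V) = C :=
      Set.inter_eq_left.2 fun x hx => subset_zariskiClosure V (hCV hx)
    rw [hCV']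
    exact (continuous_realProj n _).closure_preimage_subset _ ht
  | succ j ih =>
    obtain ⟨hcl, hb⟩ := ih (Nat.le_of_succ_le hj)
    have hij : d - (j + 1) + 1 = d - j := by omega
    rw [hij]
    obtain ⟨hdim, hN⟩ := hP (d - j) (Nat.sub_le d j)
    rw [polar, Nat.sub_sub_self (Nat.le_of_succ_le hj)] at hdim hN
    refine ⟨isClosed_cylinder_of_succ hN hC hcl fun x hx hxi =>
      subset_zariskiClosure _ (hb x hx hxi), fun x hx hxi => ?_⟩
    have hxj := hb x hx fun h =>
      hxi (interior_mono (cylinder_anti C (Nat.le_succ (d - j))) h)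
    by_contra hnot
    simp only [polarAux, Set.mem_union, not_or] at hnot
    have hconj := (conjInvariant_of_isAlgebraicOver_real hV).polarAux d j
    have hsub : realPoints (zariskiClosure (polarAux d V j)) ⊆ realPoints V := fun y hy =>
      zariskiClosure_subset_of_isAlgebraicOver hV (polarAux_subset hV d j) hy
    have hev := eventually_exists_mem_component hconj hdim hN (subset_zariskiClosure _ hxj)
      hnot.1.1 hnot.1.2 hsub
    refine hxi (mem_interior_iff_mem_nhds.2 ?_)
    filter_upwards [hev] with y hy
    obtain ⟨c, hc, hcy⟩ := hy
    exact mem_cylinder.2 ⟨c, hconn x hx hc, hcy⟩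

lemma isClosed_realPoints {n : ℕ} {V : Set (Fin n → ℂ)} (hV : IsAlgebraicOver ℝ V) :
    IsClosed (realPoints V) := by
  have h : zariskiClosure V = V :=
    (zariskiClosure_subset_of_isAlgebraicOver hV subset_rfl).antisymm (subset_zariskiClosure V)
  rw [← h]
  exact (isClosed_zeroLocus _).preimage continuous_toComplex

lemma isClosed_connectedComponentIn {X : Type*} [TopologicalSpace X] {S : Set X} (hS : IsClosed S)
    (x : X) : IsClosed (connectedComponentIn S x) := by
  by_cases hx : x ∈ S
  · refine isClosed_of_closure_subset ?_
    exact isPreconnected_connectedComponentIn.closure.subset_connectedComponentIn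
      (subset_closure (mem_connectedComponentIn hx))
      (closure_minimal (connectedComponentIn_subset S x) hS)
  · rw [connectedComponentIn_eq_empty hx]
    exact isClosed_empty

lemma finite_realPoints_of_isNoetherPosition_zero {n : ℕ} {W : Set (Fin n → ℂ)}
    (hW : IsNoetherPosition 0 W) : (realPoints W).Finite := by
  have hfin := finite_fibre_of_isIntegral hW 0
  refine (hfin.preimage (f := toComplex) ?_).subset fun y hy => ?_
  · intro x _ y _ hxy
    ext k
    exact Complex.ofReal_injective (congrFun hxy k)
  · exact ⟨subset_zariskiClosure W hy, funext fun k => absurd k.2 (Nat.not_lt_zero _)⟩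

end PolarVarieties

theorem lemma5p3 (n : ℕ) (hn : 0 < n) (d : ℕ) (Z : Set (Fin n → ℂ))
    (hZ : PolarVarieties.IsAlgebraicOver ℂ Z)
    (hd : PolarVarieties.algDim Z = (d : WithBot ℕ∞))
    (M : GL (Fin n) ℂ)
    (hreal : PolarVarieties.IsAlgebraicOver ℝ (PolarVarieties.invImage M Z))
    (hP : PolarVarieties.PropertyP d Z M)
    (C : Set (Fin n → ℝ))
    (hC : PolarVarieties.IsConnComponentOf C
      (PolarVarieties.realPoints (PolarVarieties.invImage M Z)))
    (t : ℝ)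
    (ht : t ∈ frontier ((fun y : Fin n → ℝ => y ⟨0, hn⟩) '' C)) :
    {y ∈ C | y ⟨0, hn⟩ = t}.Nonempty ∧
    {y ∈ C | y ⟨0, hn⟩ = t}.Finite ∧
    {y ∈ C | y ⟨0, hn⟩ = t} ⊆
      {y ∈ C | PolarVarieties.toComplex y ∈
        PolarVarieties.polar d (PolarVarieties.invImage M Z) 0} := by
  open PolarVarieties in
  obtain ⟨y₀, hy₀, rfl⟩ := hC
  set V := invImage M Z
  set C := connectedComponentIn (realPoints V) y₀ with hCdef
  obtain ⟨hcl, hmem⟩ := isClosed_cylinder_and_mem_polarAux hreal hP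
    (isClosed_connectedComponentIn (isClosed_realPoints hreal) y₀)
    (connectedComponentIn_subset _ _)
    (fun x hx => (connectedComponentIn_eq hx).symm.subset) d le_rfl
  rw [Nat.sub_self, zero_add, ← hCdef] at hcl hmem
  have hcyl : cylinder 1 C =
      (fun y : Fin n → ℝ => y ⟨0, hn⟩) ⁻¹' ((fun y : Fin n → ℝ => y ⟨0, hn⟩) '' C) := by
    ext y
    rw [mem_cylinder]
    refine exists_congr fun c => and_congr_right fun _ => ⟨fun h => h ⟨0, hn⟩ one_pos, ?_⟩
    intro h k hk
    obtain rfl : k = ⟨0, hn⟩ := Fin.ext (Nat.lt_one_iff.1 hk)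
    exact h
  have hfront (y : Fin n → ℝ) (hy : y ⟨0, hn⟩ = t) : y ∈ frontier (cylinder 1 C) := by
    rw [hcyl, ← (isOpenMap_eval (⟨0, hn⟩ : Fin n)).preimage_frontier_eq_frontier_preimage
      (continuous_apply _)]
    rw [← hy] at ht
    exact ht
  have hsub : {y ∈ C | y ⟨0, hn⟩ = t} ⊆ {y ∈ C | toComplex y ∈ polar d V 0} :=
    fun y hy => ⟨hy.1, hmem y hy.1 (hfront y hy.2).2⟩
  refine ⟨?_, ?_, hsub⟩
  · have h := hcl.frontier_subset (hfront (fun _ => t) rfl)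
    obtain ⟨c, hc, hct⟩ := mem_cylinder.1 h
    exact ⟨c, hc, hct ⟨0, hn⟩ one_pos⟩
  · exact (finite_realPoints_of_isNoetherPosition_zero (hP 0 (Nat.zero_le d)).2).subset
      fun y hy => (hsub hy).2
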